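/- Let $n\ge 0$, let $\phi,\varphi:\mathbb R\to\mathbb R$ be continuously differentiable with $\phi'>0$ and $\varphi'<0$ everywhere, let $\lambda>0$, and let $\mathcal P_r$ be a Borel probability measure on $\mathbb R^n$ (Euclidean norm). For a Lipschitz $f:\mathbb R^n\to\mathbb R$ let $k(f)$ be its best Lipschitz constant. For a probability measure $\mathcal P_g$ call $f$ admissible if it is Lipschitz, $\phi\circ f$ is $\mathcal P_g$-integrable and $\varphi\circ f$ is $\mathcal P_r$-integrable, and put $$J(\mathcal P_g,f)=J_D+\lambda k(f)^2,\qquad J_D=\mathbb E_{x\sim\mathcal P_g}[\phi(f(x))]+\mathbb E_{x\sim\mathcal P_r}[\varphi(f(x))].$$ An optimal discriminator $f^*$ for $\mathcal P_g$ is an admissible minimizer of $J(\mathcal P_g,\cdot)$ over all admissible functions. Let $S_r,S_g$ denote the (closed) supports of $\mathcal P_r,\mathcal P_g$. If $\mathcal P_r,\mathcal P_g$ have Lebesgue densities $p_r,p_g$, let $U_r=\{p_r\ne0\}$, $U_g=\{p_g\neq 0\}$ and let $D(x)$ be the derivative at $t=f^*(x)$ of $t\mapsto p_g(x)\phi(t)+p_r(x)\varphi(t)$.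 Say that $y$ bounds $x$ if $y\ne x$ and $|f^*(y)-f^*(x)|=k(f^*)\|y-x\|$. Suppose that $\mathcal P_r$ and $\mathcal P_g$ have continuous densities and that $f^*$ is an optimal discriminator for $\mathcal P_g$. Then: (a) Every $x\in S_r\cup S_g$ with $D(x)\ne0$ is bounded by some $y\in U_r\cup U_g\subseteq S_r\cup S_g$. (b) Every $x\in (U_r\cup U_g)\setminus(U_r\cap U_g)$ is bounded by some $y\in U_r\cup U_g$. If $S_r\cup S_g$ is bounded, then also every $x\in(S_r\cup S_g)\setminus(S_r\cap S_g)$ is bounded by some $y\in S_r\cup S_g$. (c) Suppose that $\phi,\varphi$ are convex or that $S_r\cup S_g$ is bounded. If $S_r=S_g$ and $\mathcal P_r\ne\mathcal P_g$, then there are $x,y\in U_r\cup U_g$ such that $y$ bounds $x$ and $D(x)\neq0$. (d) Call $(\mathcal P_g,f)$, with $\mathcal P_g$ any Borel probability measure on $\mathbb R^n$, a Nash equilibrium if $f$ is an optimal discriminator for $\mathcal P_g$ and $J(\mathcal Q,f)\le J(\mathcal P_g,f)$ for every Borel probability measure $\mathcal Q$ for which $\phi\circ f$ is integrable (for this, $\mathcal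 P_r$ need not have a density). Every Nash equilibrium satisfies $\mathcal P_g=\mathcal P_r$ and $k(f)=0$. If $\phi,\varphi$ are convex and $\phi'(a)+\varphi'(a)=0$ for some $a$, then a Nash equilibrium with $\mathcal P_g=\mathcal P_r$ exists; if moreover $\phi$ or $\varphi$ is strictly convex, there is exactly one Nash equilibrium $(\mathcal P_g,f)$. Furthermore, in the setting of (a) and under the hypothesis of (c) that $\phi,\varphi$ are convex or $S_r\cup S_g$ is bounded, if $f^*$ is differentiable and $D(x)\nabla f^*(x)=0$ for all $x\in S_r\cup S_g$, then $\mathcal P_g=\mathcal P_r$ and $k(f^*)=0$. -/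

import Mathlib

open MeasureTheory
open scoped NNReal

noncomputable section

/-- Data space `ℝⁿ` with the Euclidean norm. -/
abbrev Pt (n : ℕ) : Type := EuclideanSpace ℝ (Fin n)

/-- The best Lipschitz constant `k(f)` (used only for Lipschitz `f`). -/
def lipConst {n : ℕ} (f : Pt n → ℝ) : ℝ≥0 := sInf {K : ℝ≥0 | LipschitzWith K f}

/-- `J_D = E_{x ∼ P_g} φ(f x) + E_{x ∼ P_r} ϕ(f x)`. -/
def discLoss {n : ℕ} (phi vphi : ℝ → ℝ) (Pr Pg : Measure (Pt n)) (f : Pt n → ℝ) : ℝ :=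
  (∫ x, phi (f x) ∂Pg) + ∫ x, vphi (f x) ∂Pr

/-- The penalized objective `J = J_D + lam * k(f)^2`. -/
def penObj {n : ℕ} (phi vphi : ℝ → ℝ) (lam : ℝ) (Pr Pg : Measure (Pt n)) (f : Pt n → ℝ) : ℝ :=
  discLoss phi vphi Pr Pg f + lam * (lipConst f : ℝ) ^ 2

/-- Discriminators at which the penalized objective is finite: `f` is Lipschitz and both
expectations exist. -/
def Admissible {n : ℕ} (phi vphi : ℝ → ℝ) (Pr Pg : Measure (Pt n)) (f : Pt n → ℝ) : Prop :=
  (∃ K : ℝ≥0, LipschitzWith K f) ∧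
    Integrable (fun x => phi (f x)) Pg ∧ Integrable (fun x => vphi (f x)) Pr

/-- `f` is an optimal discriminator: a global minimizer of the penalized objective. -/
def IsOptimalDisc {n : ℕ} (phi vphi : ℝ → ℝ) (lam : ℝ) (Pr Pg : Measure (Pt n))
    (f : Pt n → ℝ) : Prop :=
  Admissible phi vphi Pr Pg f ∧
    ∀ g : Pt n → ℝ, Admissible phi vphi Pr Pg g →
      penObj phi vphi lam Pr Pg f ≤ penObj phi vphi lam Pr Pg g

/-- `p` is a continuous density of `P` with respect to Lebesgue measure. -/
structure HasContDensity {n : ℕ} (P : Measure (Pt n)) (p : Pt n → ℝ) : Prop where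
  continuous : Continuous p
  nonneg : ∀ x, 0 ≤ p x
  eq_withDensity : P = (volume : Measure (Pt n)).withDensity (fun x => ENNReal.ofReal (p x))

/-- The pointwise objective at `x`, as a function of the value `t = f x`:
`p_g(x) φ(t) + p_r(x) ϕ(t)`. -/
def ptLoss {n : ℕ} (phi vphi : ℝ → ℝ) (pr pg : Pt n → ℝ) (x : Pt n) (t : ℝ) : ℝ :=
  pg x * phi t + pr x * vphi t

/-- The derivative of the pointwise objective at `x` with respect to the value `f x`. -/
def ptGrad {n : ℕ} (phi vphi : ℝ → ℝ) (pr pg : Pt n → ℝ) (f : Pt n → ℝ) (x : Pt n) : ℝ :=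
  deriv (ptLoss phi vphi pr pg x) (f x)

/-- `x` and `y` are distinct points in a bounding relationship. -/
def Bounds {n : ℕ} (f : Pt n → ℝ) (x y : Pt n) : Prop :=
  y ≠ x ∧ |f y - f x| = (lipConst f : ℝ) * ‖y - x‖

/-- Nash equilibrium of the zero-sum game with payoff `J`: the discriminator `f` minimizes and
the generator, whose strategies are the Borel probability measures on `ℝⁿ`, maximizes. -/
def IsNash {n : ℕ} (phi vphi : ℝ → ℝ) (lam : ℝ) (Pr Pg : Measure (Pt n)) (f : Pt n → ℝ) : Prop :=
  IsProbabilityMeasure Pg ∧ IsOptimalDisc phi vphi lam Pr Pg f ∧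
    ∀ Q : Measure (Pt n), IsProbabilityMeasure Q → Integrable (fun x => phi (f x)) Q →
      penObj phi vphi lam Pr Q f ≤ penObj phi vphi lam Pr Pg f

/-- First-order equilibrium: the discriminator is optimal and differentiable, and at every sample
the gradient `∂(pointwise objective)/∂f(x) · ∂f(x)/∂x` that moves the sample is zero. -/
def IsFirstOrderEquilibrium {n : ℕ} (phi vphi : ℝ → ℝ) (lam : ℝ) (Pr Pg : Measure (Pt n))
    (pr pg : Pt n → ℝ) (f : Pt n → ℝ) : Prop :=
  IsOptimalDisc phi vphi lam Pr Pg f ∧ Differentiable ℝ f ∧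
    ∀ x ∈ Pr.support ∪ Pg.support, ptGrad phi vphi pr pg f x • gradient f x = 0

end

/-!
Everything comes from testing optimality against three competitors. Here `U_r` and `U_g` are the
sets where the two densities are nonzero.

* If no `y ∈ U_r ∪ U_g` bounds `x`, then `f` can be cut near `x` by a cone of slope `k(f)` whose
  apex lies slightly below `(x, f x)`. This lowers `f` near `x` without increasing `k(f)`, so
  optimality excludes `D(x) > 0`; the case `D(x) < 0` follows by negating `f`, which exchanges the
  roles of the two distributions. When the supports are bounded, the same cut with its apex over a
  point `z ∈ U_g` yields a `y ∈ S_r` with `f(y) ≥ f(z) + k(f) ‖y - z‖`, and compactness of `S_r`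
  extends this to every `z ∈ S_g`. If `z ∉ S_r`, then `y ≠ z`, so `y` bounds `z`.
* If `D` vanishes everywhere, then shrinking `f` to `(1 - ε) f` changes `J_D` by `o(ε)` only, while
  the penalty drops by at least `ε λ k(f)²`. Hence `k(f) = 0`.
* If `f = t` is constant, then perturbing it by bounded Lipschitz functions `u` gives
  `φ'(t) E_{P_g}[u] + ϕ'(t) E_{P_r}[u] = 0`. Taking `u = 1` yields `ϕ'(t) = -φ'(t)`, so `P_g` and
  `P_r` integrate every bounded Lipschitz function equally and therefore coincide.

In a Nash equilibrium the generator may move to any point mass, so `f` attains its maximum; the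
constant with that value has at most the same expected loss and no penalty.
-/

open Filter Topology

section Lipschitz

/-- The function `f` cut from above by the cone of slope `K` whose apex lies `δ` below the graph of
`f` over `x`. It is the competitor that shows an optimal discriminator to be tight. -/
def coneCut {X : Type*} [PseudoMetricSpace X] (K : ℝ≥0) (f : X → ℝ) (x : X) (δ : ℝ) (y : X) : ℝ :=
  min (f y) (f x - δ + K * dist y x)

section PseudoMetricSpace

variable {X : Type*} [PseudoMetricSpace X] {K : ℝ≥0} {f : X → ℝ} {x y z : X} {δ : ℝ}

theorem lipschitzWith_const_add_mul (hf : LipschitzWith K f) (t ε : ℝ) :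
    LipschitzWith (‖ε‖₊ * K) fun x => t + ε * f x :=
  ((LipschitzWith.const t).add ((lipschitzWith_smul ε).comp hf)).weaken (zero_add _).le

theorem coneCut_le : coneCut K f x δ y ≤ f y :=
  min_le_left _ _

theorem coneCut_eq_iff : coneCut K f x δ y = f y ↔ f y ≤ f x - δ + K * dist y x :=
  min_eq_left_iff

theorem coneCut_apex_lt (hδ : 0 < δ) : coneCut K f x δ x < f x :=
  (min_le_right _ _).trans_lt (by simpa using hδ)

theorem sub_le_coneCut (hf : LipschitzWith K f) (hδ : 0 ≤ δ) : f y - δ ≤ coneCut K f x δ y :=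
  le_min (by linarith) (by linarith [hf.le_add_mul y x])

theorem lipschitzWith_coneCut (hf : LipschitzWith K f) (x : X) (δ : ℝ) :
    LipschitzWith K (coneCut K f x δ) := by
  have hcone : LipschitzWith K fun y => f x - δ + K * dist y x :=
    LipschitzWith.of_le_add_mul K fun y z => by
      linarith [mul_le_mul_of_nonneg_left (dist_triangle y z x) K.coe_nonneg]
  exact (hf.min hcone).weaken (max_self K).le

theorem eventually_forall_coneCut_eq {C : Set X} (hC : IsCompact C) (hf : ContinuousOn f C)
    (h : ∀ y ∈ C, f y < f x + K * dist y x) :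
    ∀ᶠ δ in 𝓝[>] (0 : ℝ), ∀ y ∈ C, coneCut K f x δ y = f y := by
  have hcont : ContinuousOn (fun y => f x + K * dist y x - f y) C := by fun_prop
  obtain ⟨δ₀, hδ₀, hgap⟩ := hC.exists_forall_le' hcont fun y hy => sub_pos.2 (h y hy)
  filter_upwards [Ioc_mem_nhdsGT hδ₀] with δ hδ y hy
  exact coneCut_eq_iff.2 (by linarith [hδ.2, hgap y hy])

theorem mul_dist_le_abs_sub_of_dist_add_dist_eq (hf : LipschitzWith K f)
    (hxy : |f y - f x| = K * dist x y) (hz : dist x z + dist z y = dist x y) :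
    K * dist x z ≤ |f z - f x| := by
  have hyz : |f y - f z| ≤ K * dist z y := by
    simpa only [Real.dist_eq, dist_comm y z] using hf.dist_le_mul y z
  have htri := abs_sub_le (f y) (f z) (f x)
  rw [hxy, ← hz, mul_add] at htri
  linarith

end PseudoMetricSpace

section NormedSpace

variable {E : Type*} [NormedAddCommGroup E] [NormedSpace ℝ E] {K : ℝ≥0} {f : E → ℝ} {x y : E}
  {δ r : ℝ}

theorem coneCut_eq_of_forall_mem_sphere (hf : LipschitzWith K f) (hr : 0 < r)
    (h : ∀ z ∈ Metric.sphere x r, coneCut K f x δ z = f z) (hy : r ≤ dist y x) :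
    coneCut K f x δ y = f y := by
  have hd : 0 < dist y x := hr.trans_le hy
  set z : E := AffineMap.lineMap x y (r / dist y x) with hz
  have hzx : dist z x = r := by
    rw [hz, dist_lineMap_left, Real.norm_of_nonneg (by positivity), dist_comm x y,
      div_mul_cancel₀ _ hd.ne']
  have hyz : dist y z = dist y x - r := by
    have hle : r / dist y x ≤ 1 := (div_le_one hd).2 hy
    rw [hz, dist_comm, dist_lineMap_right, Real.norm_of_nonneg (sub_nonneg.2 hle), dist_comm x y,
      sub_mul, one_mul, div_mul_cancel₀ _ hd.ne']
  have hfz := coneCut_eq_iff.1 (h z hzx)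
  have hfy := hf.le_add_mul y z
  rw [hzx] at hfz
  rw [hyz, mul_sub] at hfy
  exact coneCut_eq_iff.2 (by linarith)

theorem le_norm_of_hasFDerivAt_of_abs_sub_eq {f' : E →L[ℝ] ℝ} (hf : LipschitzWith K f)
    (hne : x ≠ y) (hxy : |f y - f x| = K * dist x y) (hd : HasFDerivAt f f' x) : K ≤ ‖f'‖ := by
  have hdist : 0 < dist x y := dist_pos.2 hne
  have hline : HasDerivAt (fun s : ℝ => f (AffineMap.lineMap x y s)) (f' (y - x)) 0 :=
    HasFDerivAt.comp_hasDerivAt (0 : ℝ) (by simpa using hd) AffineMap.hasDerivAt_lineMap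
  have hslope : ∀ᶠ s in 𝓝[>] (0 : ℝ), K * dist x y ≤
      |s⁻¹ • (f (AffineMap.lineMap x y (0 + s)) - f (AffineMap.lineMap x y (0 : ℝ)))| := by
    filter_upwards [Ioc_mem_nhdsGT one_pos] with s hs
    have hxz : dist x (AffineMap.lineMap x y s : E) = s * dist x y := by
      rw [dist_left_lineMap, Real.norm_of_nonneg hs.1.le]
    have hzy : dist (AffineMap.lineMap x y s : E) y = (1 - s) * dist x y := by
      rw [dist_lineMap_right, Real.norm_of_nonneg (sub_nonneg.2 hs.2)]
    have hseg := mul_dist_le_abs_sub_of_dist_add_dist_eq hf hxy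
      (z := AffineMap.lineMap x y s) (by rw [hxz, hzy]; ring)
    rw [zero_add, AffineMap.lineMap_apply_zero, smul_eq_mul, abs_mul, abs_inv, abs_of_pos hs.1,
      le_inv_mul_iff₀ hs.1]
    rw [hxz] at hseg
    linarith
  have hle : K * dist x y ≤ ‖f'‖ * dist x y :=
    calc K * dist x y ≤ ‖f' (y - x)‖ := ge_of_tendsto hline.tendsto_slope_zero_right.abs hslope
      _ ≤ ‖f'‖ * ‖y - x‖ := f'.le_opNorm _
      _ = ‖f'‖ * dist x y := by rw [← dist_eq_norm, dist_comm]
  exact le_of_mul_le_mul_right hle hdist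

end NormedSpace

end Lipschitz

section RealFunction

variable {u : ℝ → ℝ} {t : ℝ}

theorem isMinOn_univ_of_convexOn_of_hasDerivAt_zero (hu : ConvexOn ℝ Set.univ u)
    (hd : HasDerivAt u 0 t) : IsMinOn u Set.univ t :=
  hu.isMinOn_of_rightDeriv_eq_zero (by simp)
    (hd.hasDerivWithinAt.derivWithin (uniqueDiffWithinAt_Ioi t))

theorem abs_sub_le_of_convexOn_of_hasDerivAt_zero (hu : ConvexOn ℝ Set.univ u)
    (hd : HasDerivAt u 0 t) {ε : ℝ} (hε : ε ∈ Set.Icc (0 : ℝ) 1) :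
    |u ((1 - ε) * t) - u t| ≤ ε * (u 0 - u t) := by
  have hmin : u t ≤ u ((1 - ε) * t) :=
    isMinOn_univ_of_convexOn_of_hasDerivAt_zero hu hd (Set.mem_univ _)
  have hconv := hu.2 (Set.mem_univ t) (Set.mem_univ 0) (sub_nonneg.2 hε.2) hε.1 (by ring)
  simp only [smul_eq_mul, mul_zero, add_zero] at hconv
  rw [abs_of_nonneg (sub_nonneg.2 hmin)]
  linarith

theorem exists_forall_abs_sub_le_mul_of_contDiff (hu : ContDiff ℝ 1 u) (M : ℝ) :
    ∃ N, ∀ t, |t| ≤ M → ∀ ε ∈ Set.Icc (0 : ℝ) 1, |u ((1 - ε) * t) - u t| ≤ ε * N := by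
  obtain ⟨L, hL⟩ := hu.locallyLipschitz.locallyLipschitzOn.exists_lipschitzOnWith_of_compact
    (isCompact_closedBall (0 : ℝ) M)
  refine ⟨L * M, fun t ht ε hε => ?_⟩
  have hmem : ∀ s, |s| ≤ |t| → s ∈ Metric.closedBall (0 : ℝ) M := fun s hs => by
    simpa using hs.trans ht
  have hshrink : |(1 - ε) * t| ≤ |t| := by
    rw [abs_mul, abs_of_nonneg (sub_nonneg.2 hε.2)]
    exact mul_le_of_le_one_left (abs_nonneg t) (by linarith [hε.1])
  calc |u ((1 - ε) * t) - u t| ≤ L * |(1 - ε) * t - t| :=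
        hL.dist_le_mul _ (hmem _ hshrink) _ (hmem _ le_rfl)
    _ = ε * (L * |t|) := by
        rw [show (1 - ε) * t - t = -(ε * t) by ring, abs_neg, abs_mul, abs_of_nonneg hε.1]
        ring
    _ ≤ ε * (L * M) := by
        have := hε.1
        gcongr

end RealFunction

section Integral

theorem integrable_of_eq_off_isCompact {X : Type*} [TopologicalSpace X] [T2Space X]
    [MeasurableSpace X] [OpensMeasurableSpace X] {μ : Measure X} [IsFiniteMeasureOnCompacts μ]
    {f g : X → ℝ} (hf : Integrable f μ) (hg : Continuous g) {C : Set X} (hC : IsCompact C)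
    (h : ∀ᵐ x ∂μ, x ∉ C → g x = f x) : Integrable g μ := by
  rw [← integrableOn_univ, ← Set.union_compl_self C]
  refine (hg.continuousOn.integrableOn_compact hC).union (hf.integrableOn.congr_fun_ae ?_)
  filter_upwards [ae_restrict_mem hC.measurableSet.compl, ae_restrict_of_ae h] with x hx hfg
  exact (hfg hx).symm

theorem tendsto_inv_mul_integral_zero {Ω : Type*} [MeasurableSpace Ω] {μ : Measure Ω}
    {F : ℝ → Ω → ℝ} {G : Ω → ℝ} (hF : ∀ ε, AEStronglyMeasurable (F ε) μ) (hG : Integrable G μ)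
    (hbound : ∀ x, ∀ ε ∈ Set.Icc (0 : ℝ) 1, |F ε x| ≤ ε * G x)
    (hlim : ∀ x, Tendsto (fun ε => ε⁻¹ * F ε x) (𝓝[>] 0) (𝓝 0)) :
    Tendsto (fun ε => ε⁻¹ * ∫ x, F ε x ∂μ) (𝓝[>] 0) (𝓝 0) := by
  have hle : ∀ᶠ ε in 𝓝[>] (0 : ℝ), ∀ᵐ x ∂μ, ‖ε⁻¹ * F ε x‖ ≤ G x := by
    filter_upwards [Ioc_mem_nhdsGT one_pos] with ε hε
    refine ae_of_all _ fun x => ?_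
    rw [norm_mul, norm_inv, Real.norm_of_nonneg hε.1.le, inv_mul_le_iff₀ hε.1]
    exact hbound x ε ⟨hε.1.le, hε.2⟩
  have h := tendsto_integral_filter_of_dominated_convergence G
    (Eventually.of_forall fun ε => (hF ε).const_mul ε⁻¹) hle hG (ae_of_all _ hlim)
  simpa only [integral_const_mul, integral_zero] using h

variable {Ω : Type*} [MeasurableSpace Ω] {μ : Measure Ω} [IsFiniteMeasure μ] {u : ℝ → ℝ}
  {f g h : Ω → ℝ} {c M : ℝ}

theorem integrable_comp_of_forall_mem_uIcc (hu : Continuous u) (hmono : Monotone u ∨ Antitone u)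
    (hf : Integrable (fun x => u (f x)) μ) (hg : AEStronglyMeasurable g μ)
    (h : ∀ x, g x ∈ Set.uIcc c (f x)) : Integrable (fun x => u (g x)) μ := by
  have hle : ∀ x, |u (g x) - u c| ≤ |u (f x) - u c| := fun x =>
    Set.abs_sub_left_of_mem_uIcc <| by
      rcases hmono with hm | hm <;>
        exact hm.image_uIcc_subset (Set.mem_image_of_mem u (h x))
  have hsub : Integrable (fun x => u (g x) - u c) μ :=
    (hf.sub (integrable_const (u c))).mono
      ((hu.comp_aestronglyMeasurable hg).sub aestronglyMeasurable_const) (ae_of_all _ hle)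
  exact (hsub.add (integrable_const (u c))).congr (ae_of_all _ fun x => sub_add_cancel _ _)

theorem integrable_comp_of_forall_mem_isCompact (hu : Continuous u)
    (hg : AEStronglyMeasurable g μ) {C : Set ℝ} (hC : IsCompact C) (h : ∀ x, g x ∈ C) :
    Integrable (fun x => u (g x)) μ := by
  obtain ⟨N, hN⟩ := hC.exists_bound_of_continuousOn hu.continuousOn
  exact Integrable.of_bound (hu.comp_aestronglyMeasurable hg) N (ae_of_all _ fun x => hN _ (h x))

theorem add_mul_mem_closedBall {s ε t : ℝ} (hs : |s| ≤ M) :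
    t + ε * s ∈ Metric.closedBall t (|ε| * M) := by
  rw [Metric.mem_closedBall, Real.dist_eq, add_sub_cancel_left, abs_mul]
  gcongr

theorem hasDerivAt_integral_comp_add_mul (hu : ContDiff ℝ 1 u) (hh : AEStronglyMeasurable h μ)
    (hM : ∀ x, |h x| ≤ M) (t : ℝ) :
    HasDerivAt (fun ε : ℝ => ∫ x, u (t + ε * h x) ∂μ) (deriv u t * ∫ x, h x ∂μ) 0 := by
  have hcu' : Continuous (deriv u) := hu.continuous_deriv le_rfl
  have hmeas : ∀ ε : ℝ, AEStronglyMeasurable (fun x => t + ε * h x) μ := fun ε =>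
    aestronglyMeasurable_const.add (hh.const_mul ε)
  obtain ⟨N, hN⟩ := (isCompact_closedBall t M).exists_bound_of_continuousOn hcu'.continuousOn
  have hbound : ∀ x, ∀ ε ∈ Metric.ball (0 : ℝ) 1, ‖deriv u (t + ε * h x) * h x‖ ≤ N * M := by
    intro x ε hε
    have hε1 : |ε| * M ≤ M :=
      mul_le_of_le_one_left ((abs_nonneg _).trans (hM x)) (by simpa using (Metric.mem_ball.1 hε).le)
    have hdu := hN _ (Metric.closedBall_subset_closedBall hε1 (add_mul_mem_closedBall (hM x)))
    rw [norm_mul]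
    exact mul_le_mul hdu (hM x) (norm_nonneg _) ((norm_nonneg _).trans hdu)
  have hderiv : ∀ x, ∀ ε ∈ Metric.ball (0 : ℝ) 1,
      HasDerivAt (fun ε : ℝ => u (t + ε * h x)) (deriv u (t + ε * h x) * h x) ε := fun x ε _ =>
    ((hu.differentiable one_ne_zero _).hasDerivAt).comp ε
      (by simpa using ((hasDerivAt_id ε).mul_const (h x)).const_add t)
  have key := (hasDerivAt_integral_of_dominated_loc_of_deriv_le (μ := μ)
    (F := fun ε x => u (t + ε * h x)) (Metric.ball_mem_nhds 0 one_pos)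
    (Eventually.of_forall fun ε => hu.continuous.comp_aestronglyMeasurable (hmeas ε)) (by simp)
    ((hcu'.comp_aestronglyMeasurable (hmeas 0)).mul hh)
    (ae_of_all _ hbound) (integrable_const _) (ae_of_all _ hderiv)).2
  simpa only [zero_mul, add_zero, integral_const_mul] using key

theorem measure_eq_of_forall_lipschitzWith_integral_eq {X : Type*} [PseudoEMetricSpace X]
    [MeasurableSpace X] [BorelSpace X] {P Q : Measure X} [IsProbabilityMeasure P]
    [IsProbabilityMeasure Q]
    (h : ∀ u : X → ℝ, (∃ M : ℝ, ∀ x, |u x| ≤ M) → (∃ L : ℝ≥0, LipschitzWith L u) →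
      ∫ x, u x ∂P = ∫ x, u x ∂Q) : P = Q := by
  let P' : ProbabilityMeasure X := ⟨P, inferInstance⟩
  let Q' : ProbabilityMeasure X := ⟨Q, inferInstance⟩
  have hlim : Tendsto (fun _ : ℕ => P') atTop (𝓝 Q') := by
    refine tendsto_iff_forall_lipschitz_integral_tendsto.2 fun u ⟨C, hC⟩ hL => ?_
    obtain ⟨x₀⟩ := nonempty_of_isProbabilityMeasure P
    have hbdd : ∀ x, |u x| ≤ C + |u x₀| := fun x => by
      linarith [(abs_sub_abs_le_abs_sub (u x) (u x₀)).trans (hC x x₀)]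
    exact tendsto_const_nhds.congr' (Eventually.of_forall fun _ => (h u ⟨_, hbdd⟩ hL).symm)
  have hPQ : P' = Q' := tendsto_nhds_unique tendsto_const_nhds hlim
  exact congrArg Subtype.val hPQ

end Integral

theorem isClosed_setOf_exists_mem_prodMk_mem {X Y : Type*} [TopologicalSpace X]
    [TopologicalSpace Y] {C : Set X} (hC : IsCompact C) {s : Set (X × Y)} (hs : IsClosed s) :
    IsClosed {z | ∃ y ∈ C, (y, z) ∈ s} := by
  have : CompactSpace C := isCompact_iff_compactSpace.1 hC
  have himage := isClosedMap_snd_of_compactSpace (X := C) (Y := Y) _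
    (hs.preimage (continuous_subtype_val.prodMap continuous_id))
  convert himage using 1
  ext z
  simp

section LipConst

variable {n : ℕ} {f : Pt n → ℝ} {K : ℝ≥0} {x y : Pt n}

theorem lipConst_le (h : LipschitzWith K f) : lipConst f ≤ K :=
  csInf_le (OrderBot.bddBelow _) h

theorem lipschitzWith_lipConst (hf : ∃ K : ℝ≥0, LipschitzWith K f) :
    LipschitzWith (lipConst f) f := by
  have hclosed : IsClosed {K : ℝ≥0 | LipschitzWith K f} := by
    simp only [lipschitzWith_iff_dist_le_mul, Set.ofPred_forall]
    exact isClosed_iInter fun x => isClosed_iInter fun y =>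
      isClosed_le continuous_const (by fun_prop)
  exact hclosed.csInf_mem hf (OrderBot.bddBelow _)

theorem lipConst_const (a : ℝ) : lipConst (fun _ : Pt n => a) = 0 :=
  le_antisymm (lipConst_le (LipschitzWith.const a)) bot_le

theorem eq_const_of_lipConst_eq_zero (hf : ∃ K : ℝ≥0, LipschitzWith K f) (h0 : lipConst f = 0)
    (x : Pt n) : f = fun _ => f x := by
  funext y
  have h := (lipschitzWith_lipConst hf).dist_le_mul y x
  rw [h0, NNReal.coe_zero, zero_mul] at h
  exact dist_le_zero.1 h

theorem lipschitzWith_fun_neg_iff : LipschitzWith K (fun x => -f x) ↔ LipschitzWith K f := by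
  simp only [LipschitzWith, edist_neg_neg]

theorem lipConst_neg : lipConst (fun x => -f x) = lipConst f := by
  simp only [lipConst, lipschitzWith_fun_neg_iff]

theorem bounds_neg_iff : Bounds (fun x => -f x) x y ↔ Bounds f x y := by
  rw [Bounds, Bounds, lipConst_neg, ← neg_sub_neg, neg_neg, neg_neg, abs_sub_comm]

theorem Bounds.lipConst_le_norm_gradient (hf : ∃ K : ℝ≥0, LipschitzWith K f) (h : Bounds f x y)
    (hd : DifferentiableAt ℝ f x) : lipConst f ≤ ‖gradient f x‖ := by
  rw [← (InnerProductSpace.toDual ℝ (Pt n)).norm_map]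
  exact le_norm_of_hasFDerivAt_of_abs_sub_eq (lipschitzWith_lipConst hf) h.1.symm
    (by rw [h.2, dist_comm, dist_eq_norm]) hd.hasGradientAt.hasFDerivAt

end LipConst

section Objective

variable {n : ℕ} {phi vphi : ℝ → ℝ} {lam : ℝ} {Pr Pg : Measure (Pt n)} {f g : Pt n → ℝ}

theorem Admissible.continuous (h : Admissible phi vphi Pr Pg f) : Continuous f :=
  h.1.choose_spec.continuous

theorem admissible_const [IsFiniteMeasure Pr] [IsFiniteMeasure Pg] (a : ℝ) :
    Admissible phi vphi Pr Pg (fun _ => a) :=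
  ⟨⟨0, LipschitzWith.const a⟩, integrable_const _, integrable_const _⟩

theorem penObj_const [IsProbabilityMeasure Pr] [IsProbabilityMeasure Pg] (a : ℝ) :
    penObj phi vphi lam Pr Pg (fun _ => a) = phi a + vphi a := by
  simp [penObj, discLoss, lipConst_const]

theorem Admissible.const_mul [IsFiniteMeasure Pr] [IsFiniteMeasure Pg] (hphi : Continuous phi)
    (hvphi : Continuous vphi) (hmono : Monotone phi) (hanti : Antitone vphi)
    (h : Admissible phi vphi Pr Pg f) {c : ℝ} (hc : c ∈ Set.Icc (0 : ℝ) 1) :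
    Admissible phi vphi Pr Pg (fun x => c * f x) := by
  have hmeas : Continuous fun x => c * f x := h.continuous.const_mul c
  have hmem : ∀ x, c * f x ∈ Set.uIcc 0 (f x) := fun x => by
    rw [← segment_eq_uIcc]
    exact ⟨1 - c, c, sub_nonneg.2 hc.2, hc.1, sub_add_cancel _ _, by simp⟩
  obtain ⟨K, hK⟩ := h.1
  exact ⟨⟨_, (lipschitzWith_smul c).comp hK⟩,
    integrable_comp_of_forall_mem_uIcc hphi (.inl hmono) h.2.1 hmeas.aestronglyMeasurable hmem,
    integrable_comp_of_forall_mem_uIcc hvphi (.inr hanti) h.2.2 hmeas.aestronglyMeasurable hmem⟩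

theorem Admissible.neg (h : Admissible phi vphi Pr Pg f) :
    Admissible (fun t => vphi (-t)) (fun t => phi (-t)) Pg Pr (fun x => -f x) := by
  simpa only [Admissible, neg_neg, lipschitzWith_fun_neg_iff] using ⟨h.1, h.2.2, h.2.1⟩

theorem penObj_neg : penObj (fun t => vphi (-t)) (fun t => phi (-t)) lam Pg Pr (fun x => -f x) =
    penObj phi vphi lam Pr Pg f := by
  simp only [penObj, discLoss, lipConst_neg, neg_neg, add_comm]

theorem IsOptimalDisc.neg (h : IsOptimalDisc phi vphi lam Pr Pg f) :
    IsOptimalDisc (fun t => vphi (-t)) (fun t => phi (-t)) lam Pg Pr (fun x => -f x) := by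
  refine ⟨h.1.neg, fun g hg => ?_⟩
  have hmin := h.2 (fun x => -g x) (by simpa only [neg_neg] using hg.neg)
  rw [← penObj_neg, ← penObj_neg (f := fun x => -g x)] at hmin
  simpa only [neg_neg] using hmin

theorem IsOptimalDisc.penObj_le (hlam : 0 ≤ lam) (hf : IsOptimalDisc phi vphi lam Pr Pg f)
    (hg : Admissible phi vphi Pr Pg g) {K : ℝ≥0} (hK : LipschitzWith K g) :
    penObj phi vphi lam Pr Pg f ≤ discLoss phi vphi Pr Pg g + lam * (K : ℝ) ^ 2 := by
  refine (hf.2 g hg).trans ?_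
  have hle : (lipConst g : ℝ) ≤ K := lipConst_le hK
  rw [penObj]
  gcongr

end Objective

section Density

variable {n : ℕ} {phi vphi : ℝ → ℝ} {lam : ℝ} {P Pr Pg : Measure (Pt n)} {p pr pg : Pt n → ℝ}
  {f g : Pt n → ℝ} {x : Pt n}

theorem HasContDensity.integrable_iff (hp : HasContDensity P p) (u : Pt n → ℝ) :
    Integrable u P ↔ Integrable (fun x => p x * u x) := by
  rw [hp.eq_withDensity, integrable_withDensity_iff_integrable_smul'
    hp.continuous.measurable.ennreal_ofReal (ae_of_all _ fun _ => ENNReal.ofReal_lt_top)]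
  simp only [ENNReal.toReal_ofReal (hp.nonneg _), smul_eq_mul]

theorem HasContDensity.integral_eq (hp : HasContDensity P p) (u : Pt n → ℝ) :
    ∫ x, u x ∂P = ∫ x, p x * u x := by
  rw [hp.eq_withDensity, integral_withDensity_eq_integral_toReal_smul
    hp.continuous.measurable.ennreal_ofReal (ae_of_all _ fun _ => ENNReal.ofReal_lt_top)]
  simp only [ENNReal.toReal_ofReal (hp.nonneg _), smul_eq_mul]

theorem HasContDensity.ae_density_ne_zero (hp : HasContDensity P p) : ∀ᵐ x ∂P, p x ≠ 0 := by
  rw [hp.eq_withDensity, ae_withDensity_iff hp.continuous.measurable.ennreal_ofReal]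
  exact ae_of_all _ fun x hx h0 => hx (by simp only [h0, ENNReal.ofReal_zero])

theorem HasContDensity.eq_zero_of_notMem_support (hp : HasContDensity P p)
    (hx : x ∉ P.support) : p x = 0 := by
  have hnull : volume (P.supportᶜ ∩ Function.support p) = 0 := by
    have h0 := Measure.measure_compl_support (μ := P)
    rw [hp.eq_withDensity, withDensity_apply_eq_zero hp.continuous.measurable.ennreal_ofReal,
      ← hp.eq_withDensity] at h0
    refine measure_mono_null (fun y hy => ?_) h0
    exact ⟨(ENNReal.ofReal_pos.2 ((hp.nonneg y).lt_of_ne' hy.2)).ne', hy.1⟩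
  have hempty := (Measure.isClosed_support.isOpen_compl.inter
    hp.continuous.isOpen_support).measure_eq_zero_iff volume |>.1 hnull
  by_contra hpx
  exact Set.eq_empty_iff_forall_notMem.1 hempty x ⟨hx, hpx⟩

theorem HasContDensity.support_eq (hp : HasContDensity P p) :
    P.support = closure (Function.support p) := by
  refine Set.Subset.antisymm (Measure.support_subset_of_isClosed isClosed_closure ?_)
    (closure_minimal (fun x hx => ?_) Measure.isClosed_support)
  · filter_upwards [hp.ae_density_ne_zero] with x hx using subset_closure hx
  · exact not_imp_comm.1 hp.eq_zero_of_notMem_support hx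

theorem Admissible.integrable_ptLoss (hr : HasContDensity Pr pr) (hg : HasContDensity Pg pg)
    (h : Admissible phi vphi Pr Pg f) : Integrable (fun x => ptLoss phi vphi pr pg x (f x)) :=
  ((hg.integrable_iff _).1 h.2.1).add ((hr.integrable_iff _).1 h.2.2)

theorem Admissible.discLoss_eq (hr : HasContDensity Pr pr) (hg : HasContDensity Pg pg)
    (h : Admissible phi vphi Pr Pg f) :
    discLoss phi vphi Pr Pg f = ∫ x, ptLoss phi vphi pr pg x (f x) := by
  rw [discLoss, hg.integral_eq, hr.integral_eq]
  exact (integral_add ((hg.integrable_iff _).1 h.2.1) ((hr.integrable_iff _).1 h.2.2)).symm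

theorem ptLoss_eq_zero_of_notMem_support (hx : x ∉ Function.support pr ∪ Function.support pg) :
    ptLoss phi vphi pr pg x = 0 := by
  simp only [Set.mem_union, Function.mem_support, not_or, not_not] at hx
  funext t
  simp only [ptLoss, hx.1, hx.2, zero_mul, add_zero, Pi.zero_apply]

theorem mem_support_of_ptGrad_ne_zero (h : ptGrad phi vphi pr pg f x ≠ 0) :
    x ∈ Function.support pr ∪ Function.support pg := by
  contrapose! h
  rw [ptGrad, ptLoss_eq_zero_of_notMem_support h]
  exact deriv_const _ _

theorem hasDerivAt_ptLoss (hphi : Differentiable ℝ phi) (hvphi : Differentiable ℝ vphi)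
    (x : Pt n) (t : ℝ) :
    HasDerivAt (ptLoss phi vphi pr pg x) (pg x * deriv phi t + pr x * deriv vphi t) t :=
  ((hphi t).hasDerivAt.const_mul _).add ((hvphi t).hasDerivAt.const_mul _)

theorem ptGrad_eq (hphi : Differentiable ℝ phi) (hvphi : Differentiable ℝ vphi) (x : Pt n) :
    ptGrad phi vphi pr pg f x = pg x * deriv phi (f x) + pr x * deriv vphi (f x) :=
  (hasDerivAt_ptLoss hphi hvphi x _).deriv

theorem ptGrad_ne_zero_of_mem_diff (hphi : Differentiable ℝ phi) (hvphi : Differentiable ℝ vphi)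
    (hphi' : ∀ t, deriv phi t ≠ 0) (hvphi' : ∀ t, deriv vphi t ≠ 0)
    (hx : x ∈ (Function.support pr ∪ Function.support pg) \
      (Function.support pr ∩ Function.support pg)) : ptGrad phi vphi pr pg f x ≠ 0 := by
  rw [ptGrad_eq hphi hvphi]
  obtain ⟨hr | hg, hnot⟩ := hx
  · have hg : pg x = 0 := by simpa using fun hg => hnot ⟨hr, hg⟩
    simpa only [hg, zero_mul, zero_add] using mul_ne_zero hr (hvphi' (f x))
  · have hr : pr x = 0 := by simpa using fun hr => hnot ⟨hr, hg⟩
    simpa only [hr, zero_mul, add_zero] using mul_ne_zero hg (hphi' (f x))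

theorem ptGrad_neg (x : Pt n) :
    ptGrad (fun t => vphi (-t)) (fun t => phi (-t)) pg pr (fun x => -f x) x =
      -ptGrad phi vphi pr pg f x := by
  have hcomp : ptLoss (fun t => vphi (-t)) (fun t => phi (-t)) pg pr x =
      fun t => ptLoss phi vphi pr pg x (-t) := funext fun t => add_comm _ _
  rw [ptGrad, hcomp, deriv_comp_neg, neg_neg, ptGrad]

theorem IsOptimalDisc.ptLoss_le_of_forall_ptLoss_le [IsFiniteMeasureOnCompacts Pr]
    [IsFiniteMeasureOnCompacts Pg] (hphi : Continuous phi) (hvphi : Continuous vphi)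
    (hlam : 0 ≤ lam) (hr : HasContDensity Pr pr) (hg : HasContDensity Pg pg)
    (hf : IsOptimalDisc phi vphi lam Pr Pg f) (hlip : LipschitzWith (lipConst f) g)
    {C : Set (Pt n)} (hC : IsCompact C)
    (heq : ∀ y ∈ Function.support pr ∪ Function.support pg, y ∉ C → g y = f y)
    (hle : ∀ y, ptLoss phi vphi pr pg y (g y) ≤ ptLoss phi vphi pr pg y (f y)) (x : Pt n) :
    ptLoss phi vphi pr pg x (f x) ≤ ptLoss phi vphi pr pg x (g x) := by
  have hadm : Admissible phi vphi Pr Pg g := by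
    refine ⟨⟨_, hlip⟩, integrable_of_eq_off_isCompact hf.1.2.1 (hphi.comp hlip.continuous) hC ?_,
      integrable_of_eq_off_isCompact hf.1.2.2 (hvphi.comp hlip.continuous) hC ?_⟩
    · filter_upwards [hg.ae_density_ne_zero] with y hy hyC
      rw [heq y (.inr hy) hyC]
    · filter_upwards [hr.ae_density_ne_zero] with y hy hyC
      rw [heq y (.inl hy) hyC]
  have hopt := hf.penObj_le hlam hadm hlip
  rw [penObj, hf.1.discLoss_eq hr hg, hadm.discLoss_eq hr hg] at hopt
  have hif := hf.1.integrable_ptLoss hr hg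
  have hig := hadm.integrable_ptLoss hr hg
  have hcont : Continuous fun y =>
      ptLoss phi vphi pr pg y (f y) - ptLoss phi vphi pr pg y (g y) := by
    have hrc := hr.continuous
    have hgc := hg.continuous
    have hfc := hf.1.continuous
    have hlc := hlip.continuous
    unfold ptLoss
    fun_prop
  by_contra! hlt
  have hpos : 0 < ∫ y, (ptLoss phi vphi pr pg y (f y) - ptLoss phi vphi pr pg y (g y)) :=
    integral_pos_of_integrable_nonneg_nonzero hcont (hif.sub hig)
      (fun y => sub_nonneg.2 (hle y)) (sub_pos.2 hlt).ne'
  rw [integral_sub hif hig] at hpos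
  linarith

end Density

section Bounding

variable {n : ℕ} {phi vphi : ℝ → ℝ} {lam : ℝ} {Pr Pg : Measure (Pt n)} {pr pg : Pt n → ℝ}
  {f : Pt n → ℝ} {x : Pt n}

theorem exists_pos_forall_strictMonoOn_ptLoss (hphi : ContDiff ℝ 1 phi) (hvphi : ContDiff ℝ 1 vphi)
    (hr : Continuous pr) (hg : Continuous pg) (hf : Continuous f)
    (hx : 0 < ptGrad phi vphi pr pg f x) :
    ∃ η > 0, ∀ y ∈ Metric.ball x η,
      StrictMonoOn (ptLoss phi vphi pr pg y) (Set.Icc (f y - η) (f y)) := by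
  have hdphi : Differentiable ℝ phi := hphi.differentiable one_ne_zero
  have hdvphi : Differentiable ℝ vphi := hvphi.differentiable one_ne_zero
  let D : Pt n × ℝ → ℝ := fun q =>
    pg q.1 * deriv phi (f q.1 + q.2) + pr q.1 * deriv vphi (f q.1 + q.2)
  have hD : Continuous D := by
    have := hphi.continuous_deriv le_rfl
    have := hvphi.continuous_deriv le_rfl
    fun_prop
  have hDx : 0 < D (x, 0) := by
    simpa only [D, add_zero, ← ptGrad_eq hdphi hdvphi] using hx
  obtain ⟨η, hη, hball⟩ :=
    Metric.eventually_nhds_iff_ball.1 (hD.continuousAt.eventually (lt_mem_nhds hDx))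
  refine ⟨η, hη, fun y hy => strictMonoOn_of_deriv_pos (convex_Icc _ _) (fun t _ =>
    (hasDerivAt_ptLoss hdphi hdvphi y t).continuousAt.continuousWithinAt) fun t ht => ?_⟩
  rw [interior_Icc] at ht
  have hDt : 0 < D (y, t - f y) := hball _ <| by
    rw [← ball_prod_same]
    exact ⟨hy, by rw [mem_ball_zero_iff, Real.norm_eq_abs, abs_lt]; constructor <;> linarith
      [ht.1, ht.2]⟩
  simpa only [(hasDerivAt_ptLoss hdphi hdvphi y t).deriv, D, add_sub_cancel] using hDt

theorem bounds_of_add_mul_dist_le (hf : ∃ K : ℝ≥0, LipschitzWith K f) {y : Pt n}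
    (hne : y ≠ x) (h : f x + lipConst f * dist y x ≤ f y) : Bounds f x y := by
  have heq := h.antisymm ((lipschitzWith_lipConst hf).le_add_mul y x)
  refine ⟨hne, ?_⟩
  rw [← heq, add_sub_cancel_left, ← dist_eq_norm, abs_of_nonneg (by positivity)]

theorem IsOptimalDisc.exists_bounds_of_ptGrad_pos [IsFiniteMeasureOnCompacts Pr]
    [IsFiniteMeasureOnCompacts Pg] (hphi : ContDiff ℝ 1 phi) (hvphi : ContDiff ℝ 1 vphi)
    (hlam : 0 ≤ lam) (hr : HasContDensity Pr pr) (hg : HasContDensity Pg pg)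
    (hf : IsOptimalDisc phi vphi lam Pr Pg f) (hx : 0 < ptGrad phi vphi pr pg f x) :
    ∃ y ∈ Function.support pr ∪ Function.support pg, Bounds f x y := by
  have hlip := lipschitzWith_lipConst hf.1.1
  obtain ⟨η, hη, hmono⟩ := exists_pos_forall_strictMonoOn_ptLoss hphi hvphi hr.continuous
    hg.continuous hf.1.continuous hx
  have hball : Metric.closedBall x (η / 2) ⊆ Metric.ball x η :=
    Metric.closedBall_subset_ball (half_lt_self hη)
  have hsupp : ∀ y ∈ Metric.ball x η, y ∈ Function.support pr ∪ Function.support pg := by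
    intro y hy
    by_contra hout
    have hlt := hmono y hy (Set.left_mem_Icc.2 (by linarith)) (Set.right_mem_Icc.2 (by linarith))
      (sub_lt_self _ hη)
    simp [ptLoss_eq_zero_of_notMem_support hout] at hlt
  by_contra! hno
  have hsphere : ∀ y ∈ Metric.sphere x (η / 2), f y < f x + lipConst f * dist y x := by
    intro y hy
    by_contra! hle
    exact hno y (hsupp y (hball (Metric.sphere_subset_closedBall hy)))
      (bounds_of_add_mul_dist_le hf.1.1 (Metric.ne_of_mem_sphere hy (half_pos hη).ne') hle)
  obtain ⟨δ, hcut, hδ, hδη⟩ := ((eventually_forall_coneCut_eq (isCompact_sphere x (η / 2))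
    hf.1.continuous.continuousOn hsphere).and (Ioo_mem_nhdsGT hη)).exists
  have hoff : ∀ y ∉ Metric.closedBall x (η / 2), coneCut (lipConst f) f x δ y = f y := fun y hy =>
    coneCut_eq_of_forall_mem_sphere hlip (half_pos hη) hcut (not_le.1 hy).le
  have hmem : ∀ y, coneCut (lipConst f) f x δ y ∈ Set.Icc (f y - η) (f y) := fun y =>
    ⟨by linarith [sub_le_coneCut hlip hδ.le (x := x) (y := y)], coneCut_le⟩
  have hright : ∀ y, f y ∈ Set.Icc (f y - η) (f y) := fun y =>
    Set.right_mem_Icc.2 (by linarith)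
  have hmin := hf.ptLoss_le_of_forall_ptLoss_le hphi.continuous hvphi.continuous hlam hr hg
    (lipschitzWith_coneCut hlip x δ) (isCompact_closedBall x (η / 2)) (fun y _ => hoff y)
    (fun y => ?_) x
  · exact hmin.not_gt (hmono x (Metric.mem_ball_self hη) (hmem x) (hright x) (coneCut_apex_lt hδ))
  · by_cases hy : y ∈ Metric.closedBall x (η / 2)
    · exact (hmono y (hball hy)).monotoneOn (hmem y) (hright y) coneCut_le
    · rw [hoff y hy]

theorem IsOptimalDisc.exists_bounds_of_ptGrad_ne_zero [IsFiniteMeasureOnCompacts Pr]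
    [IsFiniteMeasureOnCompacts Pg] (hphi : ContDiff ℝ 1 phi) (hvphi : ContDiff ℝ 1 vphi)
    (hlam : 0 ≤ lam) (hr : HasContDensity Pr pr) (hg : HasContDensity Pg pg)
    (hf : IsOptimalDisc phi vphi lam Pr Pg f) (hx : ptGrad phi vphi pr pg f x ≠ 0) :
    ∃ y ∈ Function.support pr ∪ Function.support pg, Bounds f x y := by
  rcases hx.lt_or_gt with hneg | hpos
  · obtain ⟨y, hy, hb⟩ := hf.neg.exists_bounds_of_ptGrad_pos (hvphi.comp contDiff_neg)
      (hphi.comp contDiff_neg) hlam hg hr ((neg_pos.2 hneg).trans_eq (ptGrad_neg x).symm)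
    exact ⟨y, hy.symm, bounds_neg_iff.1 hb⟩
  · exact hf.exists_bounds_of_ptGrad_pos hphi hvphi hlam hr hg hpos

theorem IsOptimalDisc.exists_add_mul_dist_le_of_density_ne_zero [IsFiniteMeasureOnCompacts Pr]
    [IsFiniteMeasureOnCompacts Pg] (hphi : Continuous phi) (hvphi : Continuous vphi)
    (hmono : StrictMono phi) (hlam : 0 ≤ lam) (hr : HasContDensity Pr pr)
    (hg : HasContDensity Pg pg) (hf : IsOptimalDisc phi vphi lam Pr Pg f)
    (hbdd : Bornology.IsBounded (Pr.support ∪ Pg.support)) (hx : pg x ≠ 0) :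
    ∃ y ∈ Pr.support, f x + lipConst f * dist y x ≤ f y := by
  have hlip := lipschitzWith_lipConst hf.1.1
  by_contra! hno
  have hrx : pr x = 0 := hr.eq_zero_of_notMem_support fun hxr => by simpa using hno x hxr
  obtain ⟨δ, hcut, hδ⟩ := ((eventually_forall_coneCut_eq
    (Metric.isCompact_of_isClosed_isBounded Measure.isClosed_support
      (hbdd.subset Set.subset_union_left)) hf.1.continuous.continuousOn hno).and
    self_mem_nhdsWithin).exists
  have hmin := hf.ptLoss_le_of_forall_ptLoss_le hphi hvphi hlam hr hg
    (lipschitzWith_coneCut hlip x δ) (Metric.isCompact_of_isClosed_isBounded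
      (Measure.isClosed_support.union Measure.isClosed_support) hbdd)
    (fun y hy hyS => absurd ?_ hyS) (fun y => ?_) x
  · simp only [ptLoss, hrx, zero_mul, add_zero] at hmin
    exact hmin.not_gt (mul_lt_mul_of_pos_left (hmono (coneCut_apex_lt hδ))
      ((hg.nonneg x).lt_of_ne' hx))
  · exact hy.imp (not_imp_comm.1 hr.eq_zero_of_notMem_support)
      (not_imp_comm.1 hg.eq_zero_of_notMem_support)
  · by_cases hy : y ∈ Pr.support
    · rw [hcut y hy]
    · simp only [ptLoss, hr.eq_zero_of_notMem_support hy, zero_mul, add_zero]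
      exact mul_le_mul_of_nonneg_left (hmono.monotone coneCut_le) (hg.nonneg y)

theorem IsOptimalDisc.exists_bounds_of_mem_support_gen [IsFiniteMeasureOnCompacts Pr]
    [IsFiniteMeasureOnCompacts Pg] (hphi : Continuous phi) (hvphi : Continuous vphi)
    (hmono : StrictMono phi) (hlam : 0 ≤ lam) (hr : HasContDensity Pr pr)
    (hg : HasContDensity Pg pg) (hf : IsOptimalDisc phi vphi lam Pr Pg f)
    (hbdd : Bornology.IsBounded (Pr.support ∪ Pg.support)) (hxg : x ∈ Pg.support)
    (hxr : x ∉ Pr.support) : ∃ y ∈ Pr.support, Bounds f x y := by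
  have hfc := hf.1.continuous
  have hclosed : IsClosed {z | ∃ y ∈ Pr.support,
      (y, z) ∈ {q : Pt n × Pt n | f q.2 + lipConst f * dist q.1 q.2 ≤ f q.1}} :=
    isClosed_setOf_exists_mem_prodMk_mem
      (Metric.isCompact_of_isClosed_isBounded Measure.isClosed_support
        (hbdd.subset Set.subset_union_left)) (isClosed_le (by fun_prop) (by fun_prop))
  rw [hg.support_eq] at hxg
  obtain ⟨y, hy, hxy⟩ := closure_minimal (fun z hz =>
    hf.exists_add_mul_dist_le_of_density_ne_zero hphi hvphi hmono hlam hr hg hbdd hz) hclosed hxg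
  exact ⟨y, hy, bounds_of_add_mul_dist_le hf.1.1 (ne_of_mem_of_not_mem hy hxr) hxy⟩

theorem IsOptimalDisc.exists_bounds_of_mem_support_diff [IsFiniteMeasureOnCompacts Pr]
    [IsFiniteMeasureOnCompacts Pg] (hphi : Continuous phi) (hvphi : Continuous vphi)
    (hmono : StrictMono phi) (hanti : StrictAnti vphi) (hlam : 0 ≤ lam)
    (hr : HasContDensity Pr pr) (hg : HasContDensity Pg pg)
    (hf : IsOptimalDisc phi vphi lam Pr Pg f)
    (hbdd : Bornology.IsBounded (Pr.support ∪ Pg.support))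
    (hx : x ∈ (Pr.support ∪ Pg.support) \ (Pr.support ∩ Pg.support)) :
    ∃ y ∈ Pr.support ∪ Pg.support, Bounds f x y := by
  obtain ⟨hxr | hxg, hnot⟩ := hx
  · obtain ⟨y, hy, hb⟩ := hf.neg.exists_bounds_of_mem_support_gen (hvphi.comp continuous_neg)
      (hphi.comp continuous_neg) (hanti.comp fun _ _ => neg_lt_neg) hlam hg hr
      (by rwa [Set.union_comm]) hxr fun hxg => hnot ⟨hxr, hxg⟩
    exact ⟨y, .inr hy, bounds_neg_iff.1 hb⟩
  · obtain ⟨y, hy, hb⟩ := hf.exists_bounds_of_mem_support_gen hphi hvphi hmono hlam hr hg hbdd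
      hxg fun hxr => hnot ⟨hxr, hxg⟩
    exact ⟨y, .inl hy, hb⟩

end Bounding

section VanishingGradient

variable {n : ℕ} {phi vphi : ℝ → ℝ} {lam : ℝ} {Pr Pg : Measure (Pt n)} {pr pg : Pt n → ℝ}
  {f : Pt n → ℝ}

theorem IsOptimalDisc.mul_lipConst_sq_le_discLoss_sub [IsFiniteMeasure Pr] [IsFiniteMeasure Pg]
    (hphi : Continuous phi) (hvphi : Continuous vphi) (hmono : Monotone phi)
    (hanti : Antitone vphi) (hlam : 0 ≤ lam) (hf : IsOptimalDisc phi vphi lam Pr Pg f) {ε : ℝ}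
    (hε : ε ∈ Set.Icc (0 : ℝ) 1) :
    ε * (lam * (lipConst f : ℝ) ^ 2) ≤
      discLoss phi vphi Pr Pg (fun x => (1 - ε) * f x) - discLoss phi vphi Pr Pg f := by
  have hε' : 1 - ε ∈ Set.Icc (0 : ℝ) 1 := ⟨sub_nonneg.2 hε.2, sub_le_self _ hε.1⟩
  have hopt := hf.penObj_le hlam (hf.1.const_mul hphi hvphi hmono hanti hε')
    ((lipschitzWith_smul (1 - ε)).comp (lipschitzWith_lipConst hf.1.1))
  rw [penObj, NNReal.coe_mul, coe_nnnorm, Real.norm_of_nonneg hε'.1, mul_pow] at hopt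
  have hnonneg : 0 ≤ ε * (1 - ε) * (lam * (lipConst f : ℝ) ^ 2) :=
    mul_nonneg (mul_nonneg hε.1 hε'.1) (by positivity)
  linarith

theorem abs_ptLoss_sub_le_of_ptGrad_eq_zero (hphi : Differentiable ℝ phi)
    (hvphi : Differentiable ℝ vphi) {x : Pt n}
    (hconv : ConvexOn ℝ Set.univ (ptLoss phi vphi pr pg x))
    (hgrad : ptGrad phi vphi pr pg f x = 0) {ε : ℝ} (hε : ε ∈ Set.Icc (0 : ℝ) 1) :
    |ptLoss phi vphi pr pg x ((1 - ε) * f x) - ptLoss phi vphi pr pg x (f x)| ≤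
      ε * (ptLoss phi vphi pr pg x 0 - ptLoss phi vphi pr pg x (f x)) := by
  have hd : HasDerivAt (ptLoss phi vphi pr pg x) 0 (f x) := by
    rw [← hgrad]
    exact (hasDerivAt_ptLoss hphi hvphi x (f x)).differentiableAt.hasDerivAt
  exact abs_sub_le_of_convexOn_of_hasDerivAt_zero hconv hd hε

theorem exists_integrable_abs_ptLoss_sub_le_of_isBounded [IsFiniteMeasure Pr] [IsFiniteMeasure Pg]
    (hphi : ContDiff ℝ 1 phi) (hvphi : ContDiff ℝ 1 vphi) (hr : HasContDensity Pr pr)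
    (hg : HasContDensity Pg pg) (hf : Continuous f)
    (hbdd : Bornology.IsBounded (Pr.support ∪ Pg.support)) :
    ∃ G : Pt n → ℝ, Integrable G ∧ ∀ x, ∀ ε ∈ Set.Icc (0 : ℝ) 1,
      |ptLoss phi vphi pr pg x ((1 - ε) * f x) - ptLoss phi vphi pr pg x (f x)| ≤ ε * G x := by
  obtain ⟨M, hM⟩ := (Metric.isCompact_of_isClosed_isBounded
    (Measure.isClosed_support.union Measure.isClosed_support) hbdd).exists_bound_of_continuousOn
    hf.continuousOn
  obtain ⟨N₁, hN₁⟩ := exists_forall_abs_sub_le_mul_of_contDiff hphi M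
  obtain ⟨N₂, hN₂⟩ := exists_forall_abs_sub_le_mul_of_contDiff hvphi M
  refine ⟨fun x => pg x * N₁ + pr x * N₂, ((hg.integrable_iff _).1 (integrable_const N₁)).add
    ((hr.integrable_iff _).1 (integrable_const N₂)), fun x ε hε => ?_⟩
  by_cases hx : x ∈ Pr.support ∪ Pg.support
  · have h₁ := mul_le_mul_of_nonneg_left (hN₁ (f x) (hM x hx) ε hε) (hg.nonneg x)
    have h₂ := mul_le_mul_of_nonneg_left (hN₂ (f x) (hM x hx) ε hε) (hr.nonneg x)
    calc |ptLoss phi vphi pr pg x ((1 - ε) * f x) - ptLoss phi vphi pr pg x (f x)|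
        = |pg x * (phi ((1 - ε) * f x) - phi (f x)) +
            pr x * (vphi ((1 - ε) * f x) - vphi (f x))| := by rw [ptLoss, ptLoss]; ring_nf
      _ ≤ pg x * |phi ((1 - ε) * f x) - phi (f x)| +
            pr x * |vphi ((1 - ε) * f x) - vphi (f x)| := by
          refine (abs_add_le _ _).trans_eq ?_
          rw [abs_mul, abs_mul, abs_of_nonneg (hg.nonneg x), abs_of_nonneg (hr.nonneg x)]
      _ ≤ ε * (pg x * N₁ + pr x * N₂) := by linarith
  · simp [ptLoss, hr.eq_zero_of_notMem_support fun h => hx (.inl h),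
      hg.eq_zero_of_notMem_support fun h => hx (.inr h)]

theorem Admissible.exists_integrable_abs_ptLoss_sub_le [IsFiniteMeasure Pr] [IsFiniteMeasure Pg]
    (hphi : ContDiff ℝ 1 phi) (hvphi : ContDiff ℝ 1 vphi) (hr : HasContDensity Pr pr)
    (hg : HasContDensity Pg pg) (hf : Admissible phi vphi Pr Pg f)
    (hcase : (ConvexOn ℝ Set.univ phi ∧ ConvexOn ℝ Set.univ vphi) ∨
      Bornology.IsBounded (Pr.support ∪ Pg.support))
    (hgrad : ∀ x, ptGrad phi vphi pr pg f x = 0) :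
    ∃ G : Pt n → ℝ, Integrable G ∧ ∀ x, ∀ ε ∈ Set.Icc (0 : ℝ) 1,
      |ptLoss phi vphi pr pg x ((1 - ε) * f x) - ptLoss phi vphi pr pg x (f x)| ≤ ε * G x := by
  rcases hcase with ⟨hconv, hconv'⟩ | hbdd
  · exact ⟨fun x => ptLoss phi vphi pr pg x 0 - ptLoss phi vphi pr pg x (f x),
      ((admissible_const 0).integrable_ptLoss hr hg).sub (hf.integrable_ptLoss hr hg),
      fun x ε hε => abs_ptLoss_sub_le_of_ptGrad_eq_zero (hphi.differentiable one_ne_zero)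
        (hvphi.differentiable one_ne_zero)
        ((hconv.smul (hg.nonneg x)).add (hconv'.smul (hr.nonneg x))) (hgrad x) hε⟩
  · exact exists_integrable_abs_ptLoss_sub_le_of_isBounded hphi hvphi hr hg hf.continuous hbdd

theorem tendsto_inv_mul_ptLoss_sub_of_ptGrad_eq_zero (hphi : Differentiable ℝ phi)
    (hvphi : Differentiable ℝ vphi) {x : Pt n} (hgrad : ptGrad phi vphi pr pg f x = 0) :
    Tendsto (fun ε : ℝ => ε⁻¹ *
      (ptLoss phi vphi pr pg x ((1 - ε) * f x) - ptLoss phi vphi pr pg x (f x)))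
      (𝓝[>] 0) (𝓝 0) := by
  have hin : HasDerivAt (fun ε : ℝ => (1 - ε) * f x) (-f x) 0 := by
    simpa using ((hasDerivAt_id (0 : ℝ)).const_sub 1).mul_const (f x)
  have hout : HasDerivAt (ptLoss phi vphi pr pg x) 0 ((1 - 0) * f x) := by
    rw [sub_zero, one_mul, ← hgrad]
    exact (hasDerivAt_ptLoss hphi hvphi x (f x)).differentiableAt.hasDerivAt
  simpa using (hout.comp (0 : ℝ) hin).tendsto_slope_zero_right

theorem IsOptimalDisc.lipConst_eq_zero_of_ptGrad_eq_zero [IsFiniteMeasure Pr] [IsFiniteMeasure Pg]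
    (hphi : ContDiff ℝ 1 phi) (hvphi : ContDiff ℝ 1 vphi) (hmono : Monotone phi)
    (hanti : Antitone vphi) (hlam : 0 < lam) (hr : HasContDensity Pr pr)
    (hg : HasContDensity Pg pg) (hf : IsOptimalDisc phi vphi lam Pr Pg f)
    (hcase : (ConvexOn ℝ Set.univ phi ∧ ConvexOn ℝ Set.univ vphi) ∨
      Bornology.IsBounded (Pr.support ∪ Pg.support))
    (hgrad : ∀ x, ptGrad phi vphi pr pg f x = 0) : lipConst f = 0 := by
  obtain ⟨G, hG, hbound⟩ :=
    hf.1.exists_integrable_abs_ptLoss_sub_le hphi hvphi hr hg hcase hgrad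
  have hmeas : ∀ ε : ℝ, Continuous fun x =>
      ptLoss phi vphi pr pg x ((1 - ε) * f x) - ptLoss phi vphi pr pg x (f x) := fun ε => by
    have := hr.continuous
    have := hg.continuous
    have := hf.1.continuous
    have := hphi.continuous
    have := hvphi.continuous
    unfold ptLoss
    fun_prop
  have hlim := tendsto_inv_mul_integral_zero (fun ε => (hmeas ε).aestronglyMeasurable) hG hbound
    fun x => tendsto_inv_mul_ptLoss_sub_of_ptGrad_eq_zero (hphi.differentiable one_ne_zero)
      (hvphi.differentiable one_ne_zero) (hgrad x)
  have hlow : ∀ᶠ ε in 𝓝[>] (0 : ℝ), lam * (lipConst f : ℝ) ^ 2 ≤ ε⁻¹ * ∫ x,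
      (ptLoss phi vphi pr pg x ((1 - ε) * f x) - ptLoss phi vphi pr pg x (f x)) := by
    filter_upwards [Ioc_mem_nhdsGT one_pos] with ε hε
    have hadm := hf.1.const_mul hphi.continuous hvphi.continuous hmono hanti
      (c := 1 - ε) ⟨sub_nonneg.2 hε.2, sub_le_self _ hε.1.le⟩
    rw [le_inv_mul_iff₀ hε.1, integral_sub (hadm.integrable_ptLoss hr hg)
      (hf.1.integrable_ptLoss hr hg), ← hadm.discLoss_eq hr hg, ← hf.1.discLoss_eq hr hg]
    exact hf.mul_lipConst_sq_le_discLoss_sub hphi.continuous hvphi.continuous hmono hanti hlam.le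
      ⟨hε.1.le, hε.2⟩
  have hk : lam * (lipConst f : ℝ) ^ 2 ≤ 0 := ge_of_tendsto hlim hlow
  exact_mod_cast pow_eq_zero_iff two_ne_zero |>.1
    (le_antisymm (nonpos_of_mul_nonpos_right hk hlam) (sq_nonneg _))

end VanishingGradient

section ConstantDiscriminator

variable {n : ℕ} {phi vphi : ℝ → ℝ} {lam t M : ℝ} {Pr Pg : Measure (Pt n)} {f u : Pt n → ℝ}
  {L : ℝ≥0}

theorem admissible_add_mul [IsFiniteMeasure Pr] [IsFiniteMeasure Pg] (hphi : Continuous phi)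
    (hvphi : Continuous vphi) (hL : LipschitzWith L u) (hM : ∀ x, |u x| ≤ M) (t ε : ℝ) :
    Admissible phi vphi Pr Pg fun x => t + ε * u x := by
  have hlip := lipschitzWith_const_add_mul hL t ε
  have hmem := fun x => add_mul_mem_closedBall (t := t) (ε := ε) (hM x)
  exact ⟨⟨_, hlip⟩,
    integrable_comp_of_forall_mem_isCompact hphi hlip.continuous.aestronglyMeasurable
      (isCompact_closedBall _ _) hmem,
    integrable_comp_of_forall_mem_isCompact hvphi hlip.continuous.aestronglyMeasurable
      (isCompact_closedBall _ _) hmem⟩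

theorem IsOptimalDisc.deriv_mul_integral_add_eq_zero_of_const [IsProbabilityMeasure Pr]
    [IsProbabilityMeasure Pg] (hphi : ContDiff ℝ 1 phi) (hvphi : ContDiff ℝ 1 vphi)
    (hlam : 0 ≤ lam) (hf : IsOptimalDisc phi vphi lam Pr Pg fun _ => t)
    (hL : LipschitzWith L u) (hM : ∀ x, |u x| ≤ M) :
    deriv phi t * ∫ x, u x ∂Pg + deriv vphi t * ∫ x, u x ∂Pr = 0 := by
  let J : ℝ → ℝ := fun ε => discLoss phi vphi Pr Pg (fun x => t + ε * u x) +
    lam * ((‖ε‖₊ * L : ℝ≥0) : ℝ) ^ 2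
  have hmin : IsLocalMin J 0 := Eventually.of_forall fun ε => by
    have hopt := hf.penObj_le hlam (admissible_add_mul hphi.continuous hvphi.continuous hL hM t ε)
      (lipschitzWith_const_add_mul hL t ε)
    simpa [J, penObj, lipConst_const] using hopt
  have hpen : HasDerivAt (fun ε : ℝ => lam * ((‖ε‖₊ * L : ℝ≥0) : ℝ) ^ 2) 0 0 := by
    simpa [mul_pow] using
      (((hasDerivAt_id (0 : ℝ)).pow 2).mul_const ((L : ℝ) ^ 2)).const_mul lam
  have hmeas {P : Measure (Pt n)} : AEStronglyMeasurable u P := hL.continuous.aestronglyMeasurable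
  have hJ := ((hasDerivAt_integral_comp_add_mul (μ := Pg) hphi hmeas hM t).add
    (hasDerivAt_integral_comp_add_mul (μ := Pr) hvphi hmeas hM t)).add hpen
  simpa only [add_zero] using hmin.hasDerivAt_eq_zero hJ

theorem IsOptimalDisc.measure_eq_of_const [IsProbabilityMeasure Pr] [IsProbabilityMeasure Pg]
    (hphi : ContDiff ℝ 1 phi) (hvphi : ContDiff ℝ 1 vphi) (hphi' : deriv phi t ≠ 0)
    (hlam : 0 ≤ lam) (hf : IsOptimalDisc phi vphi lam Pr Pg fun _ => t) : Pg = Pr := by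
  have hderiv : deriv vphi t = -deriv phi t := by
    have h := hf.deriv_mul_integral_add_eq_zero_of_const hphi hvphi hlam
      (LipschitzWith.const (1 : ℝ)) (fun _ => abs_one.le)
    simp only [integral_const, probReal_univ, smul_eq_mul, mul_one] at h
    linarith
  refine measure_eq_of_forall_lipschitzWith_integral_eq fun u ⟨M, hM⟩ ⟨L, hL⟩ => ?_
  have h := hf.deriv_mul_integral_add_eq_zero_of_const hphi hvphi hlam hL hM
  rw [hderiv, neg_mul, ← sub_eq_add_neg, ← mul_sub] at h
  exact sub_eq_zero.1 ((mul_eq_zero.1 h).resolve_left hphi')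

theorem IsOptimalDisc.measure_eq_of_lipConst_eq_zero [IsProbabilityMeasure Pr]
    [IsProbabilityMeasure Pg] (hphi : ContDiff ℝ 1 phi) (hvphi : ContDiff ℝ 1 vphi)
    (hphi' : ∀ t, deriv phi t ≠ 0) (hlam : 0 ≤ lam) (hf : IsOptimalDisc phi vphi lam Pr Pg f)
    (h0 : lipConst f = 0) : Pg = Pr := by
  rw [eq_const_of_lipConst_eq_zero hf.1.1 h0 0] at hf
  exact hf.measure_eq_of_const hphi hvphi (hphi' _) hlam

end ConstantDiscriminator

section Equilibrium

variable {n : ℕ} {phi vphi : ℝ → ℝ} {lam a : ℝ} {Pr Pg : Measure (Pt n)} {pr pg : Pt n → ℝ}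
  {f : Pt n → ℝ}

theorem IsOptimalDisc.exists_bounds_and_ptGrad_ne_zero [IsProbabilityMeasure Pr]
    [IsProbabilityMeasure Pg] (hphi : ContDiff ℝ 1 phi) (hvphi : ContDiff ℝ 1 vphi)
    (hphi' : ∀ t, 0 < deriv phi t) (hvphi' : ∀ t, deriv vphi t < 0) (hlam : 0 < lam)
    (hr : HasContDensity Pr pr) (hg : HasContDensity Pg pg)
    (hf : IsOptimalDisc phi vphi lam Pr Pg f)
    (hcase : (ConvexOn ℝ Set.univ phi ∧ ConvexOn ℝ Set.univ vphi) ∨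
      Bornology.IsBounded (Pr.support ∪ Pg.support)) (hne : Pr ≠ Pg) :
    ∃ x ∈ Function.support pr ∪ Function.support pg,
      ∃ y ∈ Function.support pr ∪ Function.support pg,
        Bounds f x y ∧ ptGrad phi vphi pr pg f x ≠ 0 := by
  obtain ⟨x, hx⟩ : ∃ x, ptGrad phi vphi pr pg f x ≠ 0 := by
    by_contra! hgrad
    have h0 := hf.lipConst_eq_zero_of_ptGrad_eq_zero hphi hvphi
      (strictMono_of_deriv_pos hphi').monotone (strictAnti_of_deriv_neg hvphi').antitone hlam hr hg
      hcase hgrad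
    exact hne.symm
      (hf.measure_eq_of_lipConst_eq_zero hphi hvphi (fun t => (hphi' t).ne') hlam.le h0)
  obtain ⟨y, hy, hb⟩ := hf.exists_bounds_of_ptGrad_ne_zero hphi hvphi hlam.le hr hg hx
  exact ⟨x, mem_support_of_ptGrad_ne_zero hx, y, hy, hb, hx⟩

theorem IsFirstOrderEquilibrium.eq_and_lipConst_eq_zero [IsProbabilityMeasure Pr]
    [IsProbabilityMeasure Pg] (hphi : ContDiff ℝ 1 phi) (hvphi : ContDiff ℝ 1 vphi)
    (hphi' : ∀ t, 0 < deriv phi t) (hvphi' : ∀ t, deriv vphi t < 0) (hlam : 0 < lam)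
    (hr : HasContDensity Pr pr) (hg : HasContDensity Pg pg)
    (hf : IsFirstOrderEquilibrium phi vphi lam Pr Pg pr pg f)
    (hcase : (ConvexOn ℝ Set.univ phi ∧ ConvexOn ℝ Set.univ vphi) ∨
      Bornology.IsBounded (Pr.support ∪ Pg.support)) : Pg = Pr ∧ lipConst f = 0 := by
  obtain ⟨hopt, hdiff, hcrit⟩ := hf
  suffices h0 : lipConst f = 0 from
    ⟨hopt.measure_eq_of_lipConst_eq_zero hphi hvphi (fun t => (hphi' t).ne') hlam.le h0, h0⟩
  by_cases hgrad : ∀ x, ptGrad phi vphi pr pg f x = 0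
  · exact hopt.lipConst_eq_zero_of_ptGrad_eq_zero hphi hvphi
      (strictMono_of_deriv_pos hphi').monotone (strictAnti_of_deriv_neg hvphi').antitone hlam hr hg
      hcase hgrad
  · push Not at hgrad
    obtain ⟨x, hx⟩ := hgrad
    obtain ⟨y, -, hb⟩ := hopt.exists_bounds_of_ptGrad_ne_zero hphi hvphi hlam.le hr hg hx
    have hxS : x ∈ Pr.support ∪ Pg.support := by
      rw [hr.support_eq, hg.support_eq, ← closure_union]
      exact subset_closure (mem_support_of_ptGrad_ne_zero hx)
    have hle := hb.lipConst_le_norm_gradient hopt.1.1 (hdiff x)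
    rw [(smul_eq_zero.1 (hcrit x hxS)).resolve_left hx, norm_zero] at hle
    exact_mod_cast le_antisymm hle (lipConst f).coe_nonneg

theorem IsNash.comp_le_integral (h : IsNash phi vphi lam Pr Pg f) (x : Pt n) :
    phi (f x) ≤ ∫ y, phi (f y) ∂Pg := by
  have hmax := h.2.2 (Measure.dirac x) inferInstance (integrable_dirac (by simp))
  simp only [penObj, discLoss, integral_dirac] at hmax
  linarith

theorem IsNash.lipConst_eq_zero [IsProbabilityMeasure Pr] (hmono : StrictMono phi)
    (hanti : Antitone vphi) (hlam : 0 < lam) (h : IsNash phi vphi lam Pr Pg f) :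
    lipConst f = 0 := by
  have hPg := h.1
  have hopt := h.2.1
  obtain ⟨x₀, hx₀⟩ := exists_integral_le hopt.1.2.1
  have hmax : ∀ x, f x ≤ f x₀ := fun x => hmono.le_iff_le.1 ((h.comp_le_integral x).trans hx₀)
  have hmin := hopt.2 _ (admissible_const (f x₀))
  have hvphi : vphi (f x₀) ≤ ∫ x, vphi (f x) ∂Pr := by
    simpa using integral_mono (integrable_const _) hopt.1.2.2 fun x => hanti (hmax x)
  rw [penObj_const, penObj, discLoss, (h.comp_le_integral x₀).antisymm hx₀] at hmin
  have hk : lam * (lipConst f : ℝ) ^ 2 ≤ 0 := by linarith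
  exact_mod_cast pow_eq_zero_iff two_ne_zero |>.1
    (le_antisymm (nonpos_of_mul_nonpos_right hk hlam) (sq_nonneg _))

theorem IsNash.eq_and_lipConst_eq_zero [IsProbabilityMeasure Pr] (hphi : ContDiff ℝ 1 phi)
    (hvphi : ContDiff ℝ 1 vphi) (hphi' : ∀ t, 0 < deriv phi t) (hanti : Antitone vphi)
    (hlam : 0 < lam) (h : IsNash phi vphi lam Pr Pg f) : Pg = Pr ∧ lipConst f = 0 := by
  have hPg := h.1
  have h0 := h.lipConst_eq_zero (strictMono_of_deriv_pos hphi') hanti hlam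
  exact ⟨h.2.1.measure_eq_of_lipConst_eq_zero hphi hvphi (fun t => (hphi' t).ne') hlam.le h0, h0⟩

theorem isNash_const [IsProbabilityMeasure Pr] (hmin : IsMinOn (phi + vphi) Set.univ a)
    (hlam : 0 ≤ lam) : IsNash phi vphi lam Pr Pr fun _ => a := by
  refine ⟨inferInstance, ⟨admissible_const a, fun g hg => ?_⟩, fun Q _ _ => ?_⟩
  · have hle : phi a + vphi a ≤ ∫ x, (phi (g x) + vphi (g x)) ∂Pr := by
      simpa using integral_mono (integrable_const (phi a + vphi a)) (hg.2.1.add hg.2.2)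
        fun x => hmin (Set.mem_univ (g x))
    rw [penObj_const, penObj, discLoss, ← integral_add hg.2.1 hg.2.2]
    exact hle.trans (le_add_of_nonneg_right (by positivity))
  · rw [penObj_const, penObj_const]

theorem existsUnique_isNash [IsProbabilityMeasure Pr] (hphi : ContDiff ℝ 1 phi)
    (hvphi : ContDiff ℝ 1 vphi) (hphi' : ∀ t, 0 < deriv phi t) (hanti : Antitone vphi)
    (hlam : 0 < lam) (hconv : StrictConvexOn ℝ Set.univ (phi + vphi))
    (hmin : IsMinOn (phi + vphi) Set.univ a) :
    ∃! e : Measure (Pt n) × (Pt n → ℝ), IsNash phi vphi lam Pr e.1 e.2 := by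
  refine ⟨(Pr, fun _ => a), isNash_const hmin hlam.le, fun ⟨Pg, f⟩ h => ?_⟩
  obtain ⟨rfl, h0⟩ := h.eq_and_lipConst_eq_zero hphi hvphi hphi' hanti hlam
  have hconst : f = fun _ => f 0 := eq_const_of_lipConst_eq_zero h.2.1.1.1 h0 0
  have hle : phi (f 0) + vphi (f 0) ≤ phi a + vphi a := by
    have hopt := h.2.1.2 _ (admissible_const a)
    dsimp only at hopt
    rwa [hconst, penObj_const, penObj_const] at hopt
  have hfa : f 0 = a := hconv.eq_of_isMinOn (fun t ht => hle.trans (hmin ht)) hmin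
    (Set.mem_univ _) (Set.mem_univ _)
  rw [hconst, hfa]

end Equilibrium

theorem theorem2 {n : ℕ} (phi vphi : ℝ → ℝ)
    (hphi : ContDiff ℝ 1 phi) (hvphi : ContDiff ℝ 1 vphi)
    (hphi' : ∀ t, 0 < deriv phi t) (hvphi' : ∀ t, deriv vphi t < 0)
    (lam : ℝ) (hlam : 0 < lam)
    (Pr : Measure (Pt n)) [IsProbabilityMeasure Pr] :
    (∀ (Pg : Measure (Pt n)) [IsProbabilityMeasure Pg] (pr pg : Pt n → ℝ) (f : Pt n → ℝ),
      HasContDensity Pr pr → HasContDensity Pg pg → IsOptimalDisc phi vphi lam Pr Pg f →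
        -- (a)
        (∀ x ∈ Pr.support ∪ Pg.support, ptGrad phi vphi pr pg f x ≠ 0 →
          ∃ y ∈ Function.support pr ∪ Function.support pg, Bounds f x y) ∧
        -- (b), at the points where exactly one of the densities is nonzero
        (∀ x ∈ (Function.support pr ∪ Function.support pg) \
            (Function.support pr ∩ Function.support pg),
          ∃ y ∈ Function.support pr ∪ Function.support pg, Bounds f x y) ∧
        -- (b), for the closed supports, when they are bounded
        (Bornology.IsBounded (Pr.support ∪ Pg.support) →
          ∀ x ∈ (Pr.support ∪ Pg.support) \ (Pr.support ∩ Pg.support),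
            ∃ y ∈ Pr.support ∪ Pg.support, Bounds f x y) ∧
        -- (c), and uniqueness of first-order equilibria in (d)
        ((ConvexOn ℝ Set.univ phi ∧ ConvexOn ℝ Set.univ vphi) ∨
            Bornology.IsBounded (Pr.support ∪ Pg.support) →
          (Pr.support = Pg.support → Pr ≠ Pg →
            ∃ x ∈ Function.support pr ∪ Function.support pg,
              ∃ y ∈ Function.support pr ∪ Function.support pg,
                Bounds f x y ∧ ptGrad phi vphi pr pg f x ≠ 0) ∧
          (IsFirstOrderEquilibrium phi vphi lam Pr Pg pr pg f → Pg = Pr ∧ lipConst f = 0))) ∧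
    -- (d) every Nash equilibrium
    (∀ (Pg : Measure (Pt n)) (f : Pt n → ℝ),
      IsNash phi vphi lam Pr Pg f → Pg = Pr ∧ lipConst f = 0) ∧
    -- (d) existence, and uniqueness of the pair
    (ConvexOn ℝ Set.univ phi → ConvexOn ℝ Set.univ vphi →
      (∃ a, deriv phi a + deriv vphi a = 0) →
        (∃ f : Pt n → ℝ, IsNash phi vphi lam Pr Pr f) ∧
        (StrictConvexOn ℝ Set.univ phi ∨ StrictConvexOn ℝ Set.univ vphi →
          ∃! e : Measure (Pt n) × (Pt n → ℝ), IsNash phi vphi lam Pr e.1 e.2)) := by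
  have hdphi := hphi.differentiable one_ne_zero
  have hdvphi := hvphi.differentiable one_ne_zero
  have hmono := strictMono_of_deriv_pos hphi'
  have hanti := strictAnti_of_deriv_neg hvphi'
  refine ⟨fun Pg _ pr pg f hr hg hf => ⟨fun x _ hx => ?_, fun x hx => ?_, fun hbdd x hx => ?_,
    fun hcase => ⟨fun _ hne => ?_, fun hfoe => ?_⟩⟩, fun Pg f h => ?_, fun hc hc' ⟨a, ha⟩ => ?_⟩
  · exact hf.exists_bounds_of_ptGrad_ne_zero hphi hvphi hlam.le hr hg hx
  · exact hf.exists_bounds_of_ptGrad_ne_zero hphi hvphi hlam.le hr hg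
      (ptGrad_ne_zero_of_mem_diff hdphi hdvphi (fun t => (hphi' t).ne') (fun t => (hvphi' t).ne) hx)
  · exact hf.exists_bounds_of_mem_support_diff hphi.continuous hvphi.continuous hmono hanti hlam.le
      hr hg hbdd hx
  · exact hf.exists_bounds_and_ptGrad_ne_zero hphi hvphi hphi' hvphi' hlam hr hg hcase hne
  · exact hfoe.eq_and_lipConst_eq_zero hphi hvphi hphi' hvphi' hlam hr hg hcase
  · exact h.eq_and_lipConst_eq_zero hphi hvphi hphi' hanti.antitone hlam
  · have hmin : IsMinOn (phi + vphi) Set.univ a := isMinOn_univ_of_convexOn_of_hasDerivAt_zero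
      (hc.add hc') (ha ▸ (hdphi a).hasDerivAt.add (hdvphi a).hasDerivAt)
    exact ⟨⟨_, isNash_const hmin hlam.le⟩, fun hstrict => existsUnique_isNash hphi hvphi hphi'
      hanti.antitone hlam (hstrict.elim (·.add_convexOn hc') hc.add_strictConvexOn) hmin⟩
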